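/- Let $\mathbb{K}$ be a field and let $A=\{f_n : n\in\mathbb{N}_{>0}\}$ be totally ordered by $f_n<f_m \Leftrightarrow n>m$. Let $L_{\mathbb{U}}$ be the free graded Lie algebra over $\mathbb{K}$ on generators $e_{-n}$ of degree $n$, one for each $n\ge 1$. A labeled rooted tree is a finite non-planar rooted tree with vertices labeled by $A$; $B^+_a(u)$ is the tree obtained by grafting the roots of the trees of a forest (finite multiset of trees) $u$ to a new root labeled $a$. A Hall set of labeled rooted trees is a set $H$ of such trees with a total order such that: (a) every one-vertex tree is in $H$; (b) for $a\in A$ and $u=t_1^{r_1}\cdots t_m^{r_m}$ with $m\ge1$, $t_i\in H$, $r_i\ge 1$, $t_1>\dots>t_m$, one has $B^+_a(u)\in H$ if and only if $B^+_a(t_1^{r_1}\cdots t_{m-1}^{r_{m-1}})\in H$ and $t_m>B^+_a(t_1^{r_1}\cdots t_{m-1}^{r_{m-1}})$; (c) if $t=B^+_a(u)\in H$, then every tree $s$ of $u$ is in $H$ and $s>t$. If $t=B^+_a(t_1^{r_1}\cdots t_m^{r_m})\in H$ has at least two vertices ($t_1>\dots>t_m$, $r_i\ge1$), its standard decomposition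 is $(t^1,t^2)$ with $t^1=B^+_a(t_1^{r_1}\cdots t_m^{r_m-1})$ and $t^2=t_m$. The foliage of $t\in H$ is the word $f(t)=a$ if $t$ is a single vertex labeled $a$, and $f(t)=f(t^1)f(t^2)$ otherwise. The Hall polynomial $p_t\in L_{\mathbb{U}}$ of $t\in H$ is $p_t=e_{-n}$ if $t$ is a single vertex labeled $f_n$, and $p_t=[p_{t^1},p_{t^2}]$ otherwise. A nonempty word $w$ on $A$ is Lyndon if $w<v$ in the alphabetical order for every factorization $w=uv$ into nonempty words. Then there is exactly one Hall set $\mathbf{H(T(A))}_U$ of labeled rooted trees on which the foliage is an order isomorphism onto the set of Lyndon words on $A$ with the alphabetical order, and: (i) The Hall polynomials $p_t$, $t\in \mathbf{H(T(A))}_U$, form a vector space basis of $L_{\mathbb{U}}$. (ii) The decreasing products $p_{t_1}p_{t_2}\cdots p_{t_n}$, $n\ge 0$, $t_i\in\mathbf{H(T(A))}_U$, $t_1\ge t_2\ge\dots\ge t_n$ (equivalently, with non-increasing foliages), form a vector space basis of the universal enveloping algebra $U(L_{\mathbb{U}})$. Likewise, computed with $e_{-n}=f_n$ and the concatenation product,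 they form a vector space basis of the free associative algebra $\mathbb{K}\langle f_n : n\ge 1\rangle$. -/

import Mathlib

/-! ### Labeled rooted trees and forests -/

universe u

/-- A rooted tree labeled by `A` amounts to the label of its root and the forest (a finite multiset
of labeled rooted trees) that remains when the root is removed. This is the corresponding functor. -/
def TreeShape (A : Type u) (X : Type u) : Type u := A × Multiset X

noncomputable instance TreeShape.instQPF (A : Type u) : QPF (TreeShape A) where
  map f x := (x.1, x.2.map f)
  P := ⟨A × ℕ, fun p => ULift (Fin p.2)⟩
  abs x := (x.1.1, (List.ofFn fun i => x.2 ⟨i⟩ : Multiset _))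
  repr x := ⟨(x.1, x.2.toList.length), fun i => x.2.toList.get i.down⟩
  abs_repr x := by
    rcases x with ⟨a, s⟩
    refine Prod.ext rfl ?_
    change ((List.ofFn s.toList.get : List _) : Multiset _) = s
    rw [List.ofFn_get, Multiset.coe_toList]
  abs_map f p := by
    rcases p with ⟨⟨a, n⟩, g⟩
    simp only [PFunctor.map, Multiset.map_coe, List.map_ofFn]
    rfl

/-- The set of finite, non-planar rooted trees whose vertices are labeled by `A`: the initial algebra
of `X ↦ A × Multiset X`. Thus every such tree is `node a u` for exactly one label `a` and exactly
one finite multiset `u` of such trees, and induction over trees holds; see `RTree.node_inj`,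
`RTree.exists_eq_node` and `RTree.induction`. -/
def RTree (A : Type u) : Type u := QPF.Fix (TreeShape A)

/-- Forests of labeled rooted trees (commutative monomials in trees); the empty forest is `0`. -/
abbrev Forest (A : Type u) : Type u := Multiset (RTree A)

namespace RTree

variable {A : Type u}

/-- The operator `B⁺_a`: graft the roots of the trees of the forest `u` to a new root labeled `a`. -/
noncomputable def node (a : A) (u : Forest A) : RTree A :=
  QPF.Fix.mk (F := TreeShape A) (a, u)

theorem dest_node (a : A) (u : Forest A) :
    QPF.Fix.dest (F := TreeShape A) (node a u) = (a, u) :=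
  QPF.Fix.dest_mk (F := TreeShape A) _

theorem node_inj {a b : A} {u v : Forest A} : node a u = node b v ↔ a = b ∧ u = v := by
  constructor
  · intro h
    have h2 := congrArg (QPF.Fix.dest (F := TreeShape A)) h
    rw [dest_node, dest_node] at h2
    exact ⟨congrArg Prod.fst h2, congrArg Prod.snd h2⟩
  · rintro ⟨rfl, rfl⟩
    rfl

theorem exists_eq_node (t : RTree A) : ∃ a u, t = node a u :=
  ⟨(QPF.Fix.dest (F := TreeShape A) t).1, (QPF.Fix.dest (F := TreeShape A) t).2,
    (QPF.Fix.mk_dest (F := TreeShape A) t).symm⟩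

theorem induction {p : RTree A → Prop} (h : ∀ a u, (∀ s ∈ u, p s) → p (node a u)) (t : RTree A) :
    p t := by
  refine QPF.Fix.ind (F := TreeShape A) p (fun x hx => ?_) t
  rcases hx with ⟨⟨a, y⟩, hy⟩
  have h1 : a = x.1 := congrArg Prod.fst hy
  have h2 : y.map Subtype.val = x.2 := congrArg Prod.snd hy
  refine h x.1 x.2 fun s hs => ?_
  rw [← h2] at hs
  obtain ⟨z, -, rfl⟩ := Multiset.mem_map.1 hs
  exact z.2

/-- The label of the root. -/
noncomputable def root (t : RTree A) : A := (QPF.Fix.dest (F := TreeShape A) t).1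

@[simp] theorem root_node (a : A) (u : Forest A) : (node a u).root = a :=
  congrArg Prod.fst (dest_node a u)

/-- The number of vertices (as an element of `ULift ℕ`). -/
noncomputable def sizeAux : RTree A → ULift.{u} ℕ :=
  QPF.Fix.rec (F := TreeShape A) fun x => ⟨(x.2.map ULift.down).sum + 1⟩

/-- The degree `|t|` of a tree: its number of vertices. -/
noncomputable def size (t : RTree A) : ℕ := t.sizeAux.down

theorem size_node (a : A) (u : Forest A) : (node a u).size = (u.map size).sum + 1 := by
  have h : sizeAux (node a u) = ⟨((u.map sizeAux).map ULift.down).sum + 1⟩ :=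
    QPF.Fix.rec_eq (F := TreeShape A) _ _
  rw [size, h, Multiset.map_map]
  rfl

end RTree

/-! ### Hall sets of labeled rooted trees -/

open RTree in
/-- A Hall set of `A`-labeled rooted trees: a set `carrier` of trees with a strict total order `lt`
on it (`lt s t` means `t > s`) with the properties listed below. In `node_mem_iff` the forest is
`t₁^{r₁} ⋯ t_m^{r_m}` with `t₁ > ⋯ > t_m` in the Hall set, `r_i ≥ 1` and `m ≥ 1`; there `s = t_m`,
`r = r_m`, and `v = t₁^{r₁} ⋯ t_{m-1}^{r_{m-1}}`. -/
structure HallSet (A : Type u) where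
  carrier : Set (RTree A)
  lt : RTree A → RTree A → Prop
  /-- `lt` is a relation on `carrier`. -/
  mem_of_lt : ∀ s t, lt s t → s ∈ carrier ∧ t ∈ carrier
  lt_irrefl : ∀ t, ¬ lt t t
  lt_trans : ∀ r s t, lt r s → lt s t → lt r t
  lt_total : ∀ s ∈ carrier, ∀ t ∈ carrier, lt s t ∨ s = t ∨ lt t s
  leaf_mem : ∀ a, node a 0 ∈ carrier
  node_mem_iff : ∀ (a : A) (v : Forest A) (s : RTree A) (r : ℕ), 1 ≤ r → s ∈ carrier →
    (∀ x ∈ v, x ∈ carrier ∧ lt s x) →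
    (node a (v + Multiset.replicate r s) ∈ carrier ↔ node a v ∈ carrier ∧ lt (node a v) s)
  /-- The trees hanging from the root of a Hall tree are Hall trees, larger than that tree. -/
  lt_of_mem_children : ∀ (a : A) (u : Forest A), node a u ∈ carrier →
    ∀ s ∈ u, s ∈ carrier ∧ lt (node a u) s

namespace HallSet

variable {A : Type u} (H : HallSet A)

/-- `(t₁, t₂)` is the standard decomposition of the Hall tree `t` of degree at least two: `t₂` is the
smallest of the trees hanging from the root of `t`, and `t₁` is obtained from `t` by removing one
copy of it. -/
def IsStdDecomp (t t₁ t₂ : RTree A) : Prop :=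
  ∃ (a : A) (u : Forest A), t = RTree.node a (t₂ ::ₘ u) ∧ t₁ = RTree.node a u ∧
    ∀ x ∈ u, x = t₂ ∨ H.lt t₂ x

variable {H} in
theorem IsStdDecomp.size_lt {t t₁ t₂ : RTree A} (h : H.IsStdDecomp t t₁ t₂) :
    t₁.size < t.size ∧ t₂.size < t.size := by
  obtain ⟨a, u, rfl, rfl, -⟩ := h
  have h2 : 0 < t₂.size := by
    obtain ⟨b, w, rfl⟩ := t₂.exists_eq_node
    rw [RTree.size_node]
    omega
  rw [RTree.size_node, RTree.size_node, Multiset.map_cons, Multiset.sum_cons]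
  omega

variable {H} in
theorem IsStdDecomp.unique {t t₁ t₂ s₁ s₂ : RTree A} (h : H.IsStdDecomp t t₁ t₂)
    (h' : H.IsStdDecomp t s₁ s₂) : t₁ = s₁ ∧ t₂ = s₂ := by
  obtain ⟨a, u, rfl, rfl, hu⟩ := h
  obtain ⟨b, v, hv, rfl, hv'⟩ := h'
  obtain ⟨rfl, huv⟩ := RTree.node_inj.1 hv
  have h2 : t₂ = s₂ := by
    by_contra hne
    have m1 : t₂ ∈ v := by
      have := huv ▸ Multiset.mem_cons_self t₂ u
      exact (Multiset.mem_cons.1 this).resolve_left hne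
    have m2 : s₂ ∈ u := by
      have := huv.symm ▸ Multiset.mem_cons_self s₂ v
      exact (Multiset.mem_cons.1 this).resolve_left (Ne.symm hne)
    have l1 := (hv' _ m1).resolve_left hne
    have l2 := (hu _ m2).resolve_left (Ne.symm hne)
    exact H.lt_irrefl _ (H.lt_trans _ _ _ l1 l2)
  subst h2
  exact ⟨RTree.node_inj.2 ⟨rfl, (Multiset.cons_inj_right _).1 huv⟩, rfl⟩

open Classical in
/-- The foliage of a Hall tree: `f(a) = a` for a tree with the single vertex `a`, and
`f(t) = f(t₁) f(t₂)` if `t` has the standard decomposition `(t₁, t₂)`. The words `f(t)` for `t` in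
the Hall set are its Hall words. -/
noncomputable def foliage (t : RTree A) : List A :=
  if h : ∃ p : RTree A × RTree A, H.IsStdDecomp t p.1 p.2 then
    foliage h.choose.1 ++ foliage h.choose.2
  else [t.root]
termination_by t.size
decreasing_by
  · exact h.choose_spec.size_lt.1
  · exact h.choose_spec.size_lt.2

theorem foliage_leaf (a : A) : H.foliage (RTree.node a 0) = [a] := by
  rw [foliage, dif_neg, RTree.root_node]
  rintro ⟨p, b, u, h, -⟩
  exact Multiset.cons_ne_zero (RTree.node_inj.1 h).2.symm

theorem foliage_of_isStdDecomp {t t₁ t₂ : RTree A} (h : H.IsStdDecomp t t₁ t₂) :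
    H.foliage t = H.foliage t₁ ++ H.foliage t₂ := by
  have h' : ∃ p : RTree A × RTree A, H.IsStdDecomp t p.1 p.2 := ⟨(t₁, t₂), h⟩
  rw [foliage, dif_pos h', (h'.choose_spec.unique h).1, (h'.choose_spec.unique h).2]

open Classical in
/-- The Hall polynomial `p_w`, where `w` is the foliage of the Hall tree `t`, in the free Lie algebra
on the alphabet: `p_a` is the generator attached to the letter `a`, and `p_w = [p_{w₁}, p_{w₂}]` if
`t` has the standard decomposition `(t₁, t₂)` and `w₁`, `w₂` are the foliages of `t₁`, `t₂`. -/
noncomputable def poly (K : Type*) [CommRing K] (t : RTree A) : FreeLieAlgebra K A :=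
  if h : ∃ p : RTree A × RTree A, H.IsStdDecomp t p.1 p.2 then
    ⁅poly K h.choose.1, poly K h.choose.2⁆
  else FreeLieAlgebra.of K t.root
termination_by t.size
decreasing_by
  · exact h.choose_spec.size_lt.1
  · exact h.choose_spec.size_lt.2

theorem poly_leaf (K : Type*) [CommRing K] (a : A) :
    H.poly K (RTree.node a 0) = FreeLieAlgebra.of K a := by
  rw [poly, dif_neg, RTree.root_node]
  rintro ⟨p, b, u, h, -⟩
  exact Multiset.cons_ne_zero (RTree.node_inj.1 h).2.symm

theorem poly_of_isStdDecomp (K : Type*) [CommRing K] {t t₁ t₂ : RTree A}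
    (h : H.IsStdDecomp t t₁ t₂) : H.poly K t = ⁅H.poly K t₁, H.poly K t₂⁆ := by
  have h' : ∃ p : RTree A × RTree A, H.IsStdDecomp t p.1 p.2 := ⟨(t₁, t₂), h⟩
  rw [poly, dif_pos h', (h'.choose_spec.unique h).1, (h'.choose_spec.unique h).2]

/-- The finite sequences `h₁ ≥ h₂ ≥ ⋯ ≥ h_n` (`n ≥ 0`, repetitions allowed) in a Hall set, which
index the decreasing products. They correspond to the forests of Hall trees. -/
def DecreasingSeq : Type u :=
  {l : List H.carrier // l.Pairwise fun s t => s = t ∨ H.lt t.1 s.1}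

end HallSet

/-! ### Lyndon words -/

/-- A nonempty word `w` is Lyndon if `w < v` for every factorization `w = uv` into nonempty words.
Here `<` is the alphabetical order: `u < uv` for `v` nonempty, and `w₁ a w₂ < w₁ b w₃` for letters
`a < b`. -/
def IsLyndonWord {A : Type u} [LinearOrder A] (w : List A) : Prop :=
  w ≠ [] ∧ ∀ u v : List A, u ≠ [] → v ≠ [] → w = u ++ v → w < v

/-- `H` is the Hall set of labeled rooted trees corresponding to the Lyndon words, ordered
alphabetically: the foliage is an order isomorphism of `H` onto the set of Lyndon words. -/
structure HallSet.CorrespondsToLyndon {A : Type u} [LinearOrder A] (H : HallSet A) : Prop where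
  bijOn : Set.BijOn H.foliage H.carrier {w | IsLyndonWord w}
  lt_iff : ∀ s ∈ H.carrier, ∀ t ∈ H.carrier, H.lt s t ↔ H.foliage s < H.foliage t

/-! ### The universal Hopf algebra of renormalization -/

/-- The alphabet `{f_n : n ≥ 1}` with the total order `f_n < f_m ↔ n > m`. -/
abbrev Letter : Type := ℕ+ᵒᵈ

/-- The letter `f_n`. -/
def letterF (n : ℕ+) : Letter := OrderDual.toDual n

theorem letterF_lt_iff (n m : ℕ+) : letterF n < letterF m ↔ n > m := Iff.rfl

/-- The Lie algebra `L_𝕌`: the free Lie algebra with one generator `e_{-n}` in each degree `n ≥ 1`.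
The generator `e_{-n}` is the one attached to the letter `f_n`. -/
abbrev LieU (K : Type*) [CommRing K] : Type _ := FreeLieAlgebra K Letter

/-- The generator `e_{-n}`. -/
noncomputable def genE (K : Type*) [CommRing K] (n : ℕ+) : LieU K :=
  FreeLieAlgebra.of K (letterF n)

theorem poly_letterF (K : Type*) [CommRing K] (H : HallSet Letter) (n : ℕ+) :
    H.poly K (RTree.node (letterF n) 0) = genE K n := H.poly_leaf K _

/-! ### The alphabetical order -/

section Alphabetical

variable {A : Type u} [LinearOrder A]

/-! Everything rests on unique factorization: each word is the product of exactly one non-increasing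
sequence of Lyndon words (`exists_isLyndonSeq`, `IsLyndonSeq.eq_of_flatten_eq`). A word `a w` is
Lyndon exactly when it is smaller than every Lyndon factor of `w`, so a Lyndon word unfolds
recursively into a tree with root `a` and one child per factor. This yields the Hall set
`lyndonHallSet`. In any Hall set corresponding to the Lyndon words the foliage is this same word,
which gives uniqueness.

As a noncommutative polynomial, `p_t` is its foliage plus a combination of larger rearrangements of
it (`hasLeadingWord_poly`). Leading words multiply, so by unique factorization each word leads
exactly one decreasing product. A word has finitely many rearrangements, so triangularity makes the
products a basis of the free algebra, hence of the enveloping algebra; Poincaré-Birkhoff-Witt is not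
needed.

In the free Lie algebra, independence of the `p_t` is inherited from the free algebra. For spanning,
`lie_mem_polySpan` rewrites brackets of Hall polynomials by the Jacobi identity, so their span is a
Lie subalgebra containing the generators. -/

theorem List.append_lt_append_left_iff (u v w : List A) : u ++ v < u ++ w ↔ v < w := by
  induction u with
  | nil => simp
  | cons a u ih => simpa [List.cons_lt_cons_iff] using ih

theorem List.le_append_self (u v : List A) : u ≤ u ++ v := by
  induction u with
  | nil => exact not_lt.1 (List.not_lt_nil _)
  | cons a u ih => exact List.cons_le_cons a ih

/-- Either `u` is a proper prefix of `v`, or the two words differ at some position of both. -/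
theorem List.exists_append_or_forall_append_lt {u v : List A} (h : u < v) :
    (∃ z, z ≠ [] ∧ v = u ++ z) ∨ ∀ x y, u ++ x < v ++ y := by
  induction u generalizing v with
  | nil =>
    refine Or.inl ⟨v, ?_, rfl⟩
    rintro rfl
    exact lt_irrefl _ h
  | cons a u ih =>
    cases v with
    | nil => exact absurd h (List.not_lt_nil _)
    | cons b v =>
      rcases List.cons_lt_cons_iff.1 h with hab | ⟨rfl, huv⟩
      · exact Or.inr fun x y => List.cons_lt_cons_iff.2 (Or.inl hab)
      · rcases ih huv with ⟨z, hz, rfl⟩ | h'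
        · exact Or.inl ⟨z, hz, rfl⟩
        · exact Or.inr fun x y => List.cons_lt_cons_iff.2 (Or.inr ⟨rfl, h' x y⟩)

theorem List.append_lt_append_of_length_le {u v : List A} (h : u < v) (hl : v.length ≤ u.length)
    (x y : List A) : u ++ x < v ++ y := by
  rcases List.exists_append_or_forall_append_lt h with ⟨z, hz, rfl⟩ | h'
  · rw [List.length_append] at hl
    exact absurd (List.length_eq_zero_iff.1 (by omega)) hz
  · exact h' x y

end Alphabetical

/-! ### Lyndon words and the factorization theorem -/

section Lyndon

variable {A : Type u} [LinearOrder A]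

theorem IsLyndonWord.lt_append {u v : List A} (hu : u ≠ []) (hv : IsLyndonWord v) (h : u < v) :
    u ++ v < v := by
  rcases List.exists_append_or_forall_append_lt h with ⟨z, hz, rfl⟩ | h'
  · exact (List.append_lt_append_left_iff _ _ _).2 (hv.2 u z hu hz rfl)
  · simpa using h' v []

/-- A proper suffix is either a suffix of `v`, hence at least `v > uv`, or `zv` with `z` a suffix of
`u`. If `z` is proper, then `u < z` and `z` is shorter, so the two differ at a letter and the
comparison survives appending. -/
theorem IsLyndonWord.append {u v : List A} (hu : IsLyndonWord u) (hv : IsLyndonWord v)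
    (h : u < v) : IsLyndonWord (u ++ v) := by
  refine ⟨by simp [hu.1], fun x y hx hy hxy => ?_⟩
  have huv := hv.lt_append hu.1 h
  rcases List.append_eq_append_iff.1 hxy with ⟨z, rfl, rfl⟩ | ⟨z, rfl, rfl⟩
  · by_cases hz : z = []
    · simpa [hz] using huv
    · exact huv.trans (hv.2 z y hz hy rfl)
  · by_cases hz : z = []
    · simpa [hz] using huv
    · exact List.append_lt_append_of_length_le (hu.2 x z hx hz rfl) (by simp) _ _

theorem isLyndonWord_singleton (a : A) : IsLyndonWord [a] := by
  refine ⟨by simp, fun u v hu hv h => ?_⟩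
  have := congrArg List.length h
  rw [List.length_append, List.length_singleton] at this
  have := List.length_pos_iff.2 hu
  have := List.length_pos_iff.2 hv
  omega

/-- A non-increasing sequence of Lyndon words. -/
def IsLyndonSeq (L : List (List A)) : Prop :=
  (∀ w ∈ L, IsLyndonWord w) ∧ L.Pairwise fun u v => v ≤ u

/-- A new first factor smaller than the next one merges with it into a larger Lyndon factor, and the
process repeats on a shorter sequence. -/
theorem IsLyndonSeq.exists_append (L : List (List A)) (hL : IsLyndonSeq L) (w : List A)
    (hw : IsLyndonWord w) : ∃ M : List (List A), IsLyndonSeq M ∧ M.flatten = w ++ L.flatten := by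
  induction L generalizing w with
  | nil => exact ⟨[w], ⟨by simpa using hw, by simp⟩, by simp⟩
  | cons l L ih =>
    have hl := hL.1 l (by simp)
    rcases le_or_gt l w with h | h
    · refine ⟨w :: l :: L, ⟨?_, List.pairwise_cons.2 ⟨?_, hL.2⟩⟩, by simp⟩
      · intro x hx
        rcases List.mem_cons.1 hx with rfl | hx
        · exact hw
        · exact hL.1 x hx
      · intro x hx
        rcases List.mem_cons.1 hx with rfl | hx
        · exact h
        · exact ((List.pairwise_cons.1 hL.2).1 x hx).trans h
    · obtain ⟨M, hM, e⟩ := ih ⟨fun x hx => hL.1 x (List.mem_cons_of_mem _ hx),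
        (List.pairwise_cons.1 hL.2).2⟩ _ (hw.append hl h)
      exact ⟨M, hM, by simp [e]⟩

theorem exists_isLyndonSeq (w : List A) : ∃ L : List (List A), IsLyndonSeq L ∧ L.flatten = w := by
  induction w with
  | nil => exact ⟨[], ⟨by simp, by simp⟩, rfl⟩
  | cons a w ih =>
    obtain ⟨L, hL, rfl⟩ := ih
    exact hL.exists_append L [a] (isLyndonWord_singleton a)

theorem IsLyndonWord.le_of_suffix {w x y : List A} (hw : IsLyndonWord w) (hy : y ≠ [])
    (h : w = x ++ y) : w ≤ y := by
  by_cases hx : x = []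
  · simp [h, hx]
  · exact (hw.2 x y hx hy h).le

/-- The last factor is the smallest nonempty suffix of a product of a non-increasing sequence of
Lyndon words. -/
theorem IsLyndonSeq.le_of_suffix {L : List (List A)} {l : List A} (hL : IsLyndonSeq (L ++ [l]))
    {x y : List A} (hy : y ≠ []) (h : (L ++ [l]).flatten = x ++ y) : l ≤ y := by
  induction L generalizing x with
  | nil => exact (hL.1 l (by simp)).le_of_suffix hy (by simpa using h)
  | cons m L ih =>
    have hL' : IsLyndonSeq (L ++ [l]) := ⟨fun z hz => hL.1 z (List.mem_cons_of_mem _ hz),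
      (List.pairwise_cons.1 hL.2).2⟩
    rw [List.cons_append, List.flatten_cons] at h
    rcases List.append_eq_append_iff.1 h with ⟨z, rfl, e⟩ | ⟨z, e, rfl⟩
    · exact ih hL' e
    · by_cases hz : z = []
      · subst hz
        exact ih hL' (x := []) (by simp)
      · have h1 : l ≤ m := (List.pairwise_cons.1 hL.2).1 l (by simp)
        exact (h1.trans ((hL.1 m (by simp)).le_of_suffix hz e)).trans (List.le_append_self _ _)

/-- The last factor is the smallest nonempty suffix, so the product determines it; cancel it and
induct. -/
theorem IsLyndonSeq.eq_of_flatten_eq {L M : List (List A)} (hL : IsLyndonSeq L)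
    (hM : IsLyndonSeq M) (h : L.flatten = M.flatten) : L = M := by
  have ne : ∀ (N : List (List A)) (m : List A), IsLyndonSeq (N ++ [m]) → m ≠ [] :=
    fun N m hN => (hN.1 m (by simp)).1
  induction L using List.reverseRecOn generalizing M with
  | nil =>
    rcases List.eq_nil_or_concat M with rfl | ⟨M, m, rfl⟩
    · rfl
    · exact absurd (by simpa using h : _ ∧ m = []).2 (ne M m (by simpa using hM))
  | append_singleton L l ih =>
    rcases List.eq_nil_or_concat M with rfl | ⟨M, m, rfl⟩
    · exact absurd (by simpa using h : _ ∧ l = []).2 (ne L l hL)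
    · rw [List.concat_eq_append] at *
      have e : l = m := le_antisymm
        (hL.le_of_suffix (ne M m hM) (x := M.flatten) (by simp [h]))
        (hM.le_of_suffix (ne L l hL) (x := L.flatten) (by simp [← h]))
      subst e
      have := ih (M := M) ⟨fun z hz => hL.1 z (by simp [hz]), (List.pairwise_append.1 hL.2).1⟩
        ⟨fun z hz => hM.1 z (by simp [hz]), (List.pairwise_append.1 hM.2).1⟩ (by simpa using h)
      rw [this]

/-- If `w₁ ≥ ⋯ ≥ w_k` are Lyndon words and the word `a w₁ ⋯ w_k` is smaller than a lower bound of
the `w_i`, then it is Lyndon. -/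
theorem IsLyndonSeq.isLyndonWord_cons {L : List (List A)} (hL : IsLyndonSeq L) {a : A}
    (h : ∀ m ∈ L, a :: L.flatten < m) : IsLyndonWord (a :: L.flatten) := by
  refine ⟨by simp, fun x y hx hy e => ?_⟩
  obtain ⟨b, x, rfl⟩ := List.exists_cons_of_ne_nil hx
  rw [List.cons_append, List.cons.injEq] at e
  rcases List.eq_nil_or_concat L with rfl | ⟨L, m, rfl⟩
  · exact absurd (by simpa using e.2 : _ ∧ y = []).2 hy
  · rw [List.concat_eq_append] at *
    exact (h m (by simp)).trans_le (hL.le_of_suffix hy e.2)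

theorem IsLyndonSeq.lt_of_isLyndonWord_cons {L : List (List A)} (hL : IsLyndonSeq L) {a : A}
    (h : IsLyndonWord (a :: L.flatten)) : ∀ m ∈ L, a :: L.flatten < m := by
  intro m hm
  rcases List.eq_nil_or_concat L with rfl | ⟨L, l, rfl⟩
  · exact absurd hm (by simp)
  · rw [List.concat_eq_append] at *
    have h1 : a :: (L ++ [l]).flatten < l :=
      h.2 (a :: L.flatten) l (by simp) (hL.1 l (by simp)).1 (by simp)
    rcases List.mem_append.1 hm with hm | hm
    · exact h1.trans_le ((List.pairwise_append.1 hL.2).2.2 m hm l (by simp))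
    · simpa [List.mem_singleton.1 hm] using h1

/-- Handles the multiplicity `r` in the Hall axiom. The delicate case is `s = xz`: then `s < z` with
`z` shorter, so `s⋯s < z`, and prefixing `x` gives the claim. -/
theorem IsLyndonWord.append_flatten_replicate_lt {x s : List A} (hx : x ≠ [])
    (hs : IsLyndonWord s) (h : x < s) (r : ℕ) : x ++ (List.replicate r s).flatten < s := by
  rcases List.exists_append_or_forall_append_lt h with ⟨z, hz, e⟩ | h'
  · cases r with
    | zero => simpa using h
    | succ r =>
      have h1 := hs.2 x z hx hz e
      have h2 := List.append_lt_append_of_length_le h1 (by rw [e]; simp)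
        (List.replicate r s).flatten []
      rw [List.append_nil] at h2
      conv_rhs => rw [e]
      rw [List.append_lt_append_left_iff, List.replicate_succ, List.flatten_cons]
      exact h2
  · simpa using h' _ []

end Lyndon

/-! ### The Hall set of Lyndon words -/

theorem Multiset.exists_pairwise_ge {α β : Type*} [LinearOrder β] (g : α → β) (u : Multiset α) :
    ∃ L : List α, (L : Multiset α) = u ∧ L.Pairwise fun s t => g t ≤ g s := by
  have : IsTrans α fun s t => g t ≤ g s := ⟨fun _ _ _ h h' => h'.trans h⟩
  have : Std.Total fun s t : α => g t ≤ g s := ⟨fun a b => le_total (g b) (g a)⟩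
  refine ⟨List.insertionSort (fun s t => g t ≤ g s) u.toList, ?_, List.pairwise_insertionSort _ _⟩
  rw [Multiset.coe_eq_coe.2 (List.perm_insertionSort _ _), Multiset.coe_toList]

section LyndonTrees

variable {A : Type u} [LinearOrder A]

/-! ### Trees and their words, independently of any Hall set. -/

namespace RTree

/-- The label of the root, followed by the words of its children in non-increasing order. -/
noncomputable def word : RTree A → List A :=
  QPF.Fix.rec (F := TreeShape A) fun x => x.1 :: (x.2.sort (· ≥ ·)).flatten

theorem word_node (a : A) (u : Forest A) :
    (node a u).word = a :: ((u.map word).sort (· ≥ ·)).flatten :=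
  QPF.Fix.rec_eq (F := TreeShape A) _ _

theorem word_node_coe (a : A) (L : List (RTree A))
    (hL : L.Pairwise fun s t => t.word ≤ s.word) :
    (node a (L : Forest A)).word = a :: (L.map word).flatten := by
  rw [word_node, Multiset.map_coe, Multiset.coe_sort, List.mergeSort_eq_self]
  exact List.pairwise_map.2 (hL.imp fun h => by simpa using h)

/-- The trees whose subtrees all have Lyndon words. -/
inductive IsLyndon : RTree A → Prop
  | intro (a : A) (u : Forest A) (hu : ∀ s ∈ u, IsLyndon s) (h : IsLyndonWord (node a u).word) :
    IsLyndon (node a u)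

theorem isLyndon_node (a : A) (u : Forest A) :
    (node a u).IsLyndon ↔ (∀ s ∈ u, s.IsLyndon) ∧ IsLyndonWord (node a u).word := by
  constructor
  · intro h
    generalize ht : node a u = t at h
    cases h with
    | intro b v hv h =>
      obtain ⟨rfl, rfl⟩ := node_inj.1 ht
      exact ⟨hv, h⟩
  · exact fun h => .intro a u h.1 h.2

theorem IsLyndon.isLyndonWord {t : RTree A} (h : t.IsLyndon) : IsLyndonWord t.word := by
  obtain ⟨a, u, rfl⟩ := t.exists_eq_node
  exact ((isLyndon_node a u).1 h).2

theorem isLyndonSeq_map_word {L : List (RTree A)} (h : ∀ s ∈ L, s.IsLyndon)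
    (hL : L.Pairwise fun s t => t.word ≤ s.word) : IsLyndonSeq (L.map word) := by
  refine ⟨fun w hw => ?_, List.pairwise_map.2 hL⟩
  obtain ⟨s, hs, rfl⟩ := List.mem_map.1 hw
  exact (h s hs).isLyndonWord

theorem IsLyndon.word_lt {a : A} {u : Forest A} (h : (node a u).IsLyndon) :
    ∀ s ∈ u, (node a u).word < s.word := by
  obtain ⟨L, rfl, hL⟩ := u.exists_pairwise_ge word
  obtain ⟨h1, h2⟩ := (isLyndon_node _ _).1 h
  rw [word_node_coe a L hL] at h2 ⊢
  exact fun s hs => (isLyndonSeq_map_word h1 hL).lt_of_isLyndonWord_cons h2 _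
    (List.mem_map_of_mem hs)

theorem IsLyndon.of_word_lt {a : A} {u : Forest A} (hu : ∀ s ∈ u, s.IsLyndon)
    (h : ∀ s ∈ u, (node a u).word < s.word) : (node a u).IsLyndon := by
  obtain ⟨L, rfl, hL⟩ := u.exists_pairwise_ge word
  refine .intro a _ hu ?_
  rw [word_node_coe a L hL] at h ⊢
  refine (isLyndonSeq_map_word hu hL).isLyndonWord_cons fun m hm => ?_
  obtain ⟨s, hs, rfl⟩ := List.mem_map.1 hm
  exact h s hs

theorem isLyndon_leaf (a : A) : (node a 0).IsLyndon :=
  .of_word_lt (by simp) (by simp)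

/-- The children's words are the Lyndon factorization of the word without its first letter, so the
word determines the root and, inductively, the children. -/
theorem word_injOn : Set.InjOn (word (A := A)) {t | t.IsLyndon} := by
  intro t
  induction t using RTree.induction with
  | h a u ih =>
    intro ht s hs e
    obtain ⟨b, v, rfl⟩ := s.exists_eq_node
    obtain ⟨L, rfl, hL⟩ := u.exists_pairwise_ge word
    obtain ⟨M, rfl, hM⟩ := v.exists_pairwise_ge word
    obtain ⟨h1, -⟩ := (isLyndon_node _ _).1 ht
    obtain ⟨h2, -⟩ := (isLyndon_node _ _).1 hs
    rw [word_node_coe a L hL, word_node_coe b M hM, List.cons.injEq] at e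
    have e' := (isLyndonSeq_map_word h1 hL).eq_of_flatten_eq (isLyndonSeq_map_word h2 hM) e.2
    rw [node_inj]
    refine ⟨e.1, congrArg _ ?_⟩
    clear e hL hM ht hs
    induction L generalizing M with
    | nil => exact (by simpa using e'.symm : M = []).symm
    | cons x L ihL =>
      cases M with
      | nil => simp at e'
      | cons y M =>
        rw [List.map_cons, List.map_cons, List.cons.injEq] at e'
        rw [ih x (by simp) (h1 x (by simp)) (h2 y (by simp)) e'.1,
          ihL (fun s hs => ih s (List.mem_cons_of_mem _ hs)) M
            (fun s hs => h1 s (List.mem_cons_of_mem _ hs))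
            (fun s hs => h2 s (List.mem_cons_of_mem _ hs)) e'.2]

theorem exists_isLyndon_word_eq {w : List A} (hw : IsLyndonWord w) :
    ∃ t : RTree A, t.IsLyndon ∧ t.word = w := by
  induction hn : w.length using Nat.strong_induction_on generalizing w with
  | _ n ih =>
    subst hn
    obtain ⟨a, w, rfl⟩ := List.exists_cons_of_ne_nil hw.1
    obtain ⟨L, hL, rfl⟩ := exists_isLyndonSeq w
    have key : ∀ M : List (List A), (∀ m ∈ M, IsLyndonWord m ∧ m.length < (a :: L.flatten).length) →
        ∃ N : List (RTree A), (∀ s ∈ N, s.IsLyndon) ∧ N.map word = M := by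
      intro M hM
      induction M with
      | nil => exact ⟨[], by simp, rfl⟩
      | cons m M ihM =>
        obtain ⟨N, hN, rfl⟩ := ihM fun x hx => hM x (List.mem_cons_of_mem _ hx)
        obtain ⟨t, ht, rfl⟩ := ih _ (hM m (by simp)).2 (hM m (by simp)).1 rfl
        exact ⟨t :: N, by simpa using ⟨ht, hN⟩, rfl⟩
    obtain ⟨N, hN, rfl⟩ := key L fun m hm => ⟨hL.1 m hm, by
      have := (List.sublist_flatten_of_mem hm).length_le
      rw [List.length_cons]
      omega⟩
    have e := word_node_coe a N (List.pairwise_map.1 hL.2)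
    exact ⟨node a N, .intro a _ hN (e ▸ hw), e⟩

end RTree

open RTree

/-- The Hall set of the trees all of whose subtrees have Lyndon words, ordered by their words. -/
noncomputable def lyndonHallSet (A : Type u) [LinearOrder A] : HallSet A where
  carrier := {t | t.IsLyndon}
  lt s t := s.IsLyndon ∧ t.IsLyndon ∧ s.word < t.word
  mem_of_lt _ _ h := ⟨h.1, h.2.1⟩
  lt_irrefl _ h := lt_irrefl _ h.2.2
  lt_trans _ _ _ h h' := ⟨h.1, h'.2.1, h.2.2.trans h'.2.2⟩
  lt_total s hs t ht := by
    rcases lt_trichotomy s.word t.word with h | h | h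
    · exact Or.inl ⟨hs, ht, h⟩
    · exact Or.inr (Or.inl (word_injOn hs ht h))
    · exact Or.inr (Or.inr ⟨ht, hs, h⟩)
  leaf_mem := isLyndon_leaf
  node_mem_iff a v s r hr hs hv := by
    obtain ⟨L, rfl, hL⟩ := v.exists_pairwise_ge word
    have hLr : (L ++ List.replicate r s).Pairwise fun s t => t.word ≤ s.word := by
      refine List.pairwise_append.2 ⟨hL, List.pairwise_replicate.2 (Or.inr le_rfl), ?_⟩
      intro x hx y hy
      rw [List.eq_of_mem_replicate hy]
      exact (hv x hx).2.2.2.le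
    rw [← Multiset.coe_replicate, Multiset.coe_add]
    have e1 := word_node_coe a L hL
    have e2 := word_node_coe a _ hLr
    rw [List.map_append, List.map_replicate, List.flatten_append, ← List.cons_append, ← e1] at e2
    constructor
    · intro h
      -- The word of the tree without the copies of `s` is a prefix of the whole word, which is
      -- smaller than its child `s`.
      have h1 : (node a (L : Forest A)).word < s.word := by
        refine lt_of_le_of_lt ?_ (IsLyndon.word_lt h s (by
          simpa using Or.inr (Nat.one_le_iff_ne_zero.1 hr)))
        rw [e2]
        exact List.le_append_self _ _
      have h2 : (node a (L : Forest A)).IsLyndon :=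
        .of_word_lt (fun x hx => (hv x hx).1) fun x hx => h1.trans (hv x hx).2.2.2
      exact ⟨h2, h2, hs, h1⟩
    · rintro ⟨h, -, -, h1⟩
      have h2 := hs.isLyndonWord.append_flatten_replicate_lt h.isLyndonWord.1 h1 r
      rw [← e2] at h2
      refine .of_word_lt ?_ ?_ <;> intro x hx <;> rcases List.mem_append.1 hx with hx | hx
      · exact (hv x hx).1
      · exact List.eq_of_mem_replicate hx ▸ hs
      · exact h2.trans (hv x hx).2.2.2
      · exact List.eq_of_mem_replicate hx ▸ h2
  lt_of_mem_children a u h s hs :=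
    ⟨((isLyndon_node a u).1 h).1 s hs, h, ((isLyndon_node a u).1 h).1 s hs, h.word_lt s hs⟩

end LyndonTrees

/-! ### Foliage as a word, and uniqueness of the Hall set of Lyndon words. -/

namespace HallSet

/-- Each standard decomposition splits off the smallest remaining child, so the children's foliages
appear in decreasing order of the children. -/
theorem foliage_node_coe {A : Type u} (H : HallSet A) (a : A) (L : List (RTree A))
    (hL : L.Pairwise fun s t => s = t ∨ H.lt t s) :
    H.foliage (RTree.node a (L : Forest A)) = a :: (L.map H.foliage).flatten := by
  induction L using List.reverseRecOn with
  | nil => exact H.foliage_leaf a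
  | append_singleton L l ih =>
    obtain ⟨h1, -, h2⟩ := List.pairwise_append.1 hL
    have h : H.IsStdDecomp (RTree.node a ((L ++ [l] : List (RTree A)) : Forest A))
        (RTree.node a (L : Forest A)) l := by
      refine ⟨a, L, ?_, rfl, fun x hx => h2 x hx l (by simp)⟩
      rw [RTree.node_inj, Multiset.cons_coe]
      exact ⟨rfl, Multiset.coe_eq_coe.2 (List.perm_append_singleton l L)⟩
    rw [H.foliage_of_isStdDecomp h, ih h1]
    simp

section

variable {A : Type u} [LinearOrder A]

theorem foliage_lyndonHallSet {t : RTree A} (ht : t.IsLyndon) :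
    (lyndonHallSet A).foliage t = t.word := by
  induction ht with
  | intro a u hu h ih =>
    obtain ⟨L, rfl, hL⟩ := u.exists_pairwise_ge RTree.word
    rw [RTree.word_node_coe a L hL, foliage_node_coe, List.map_congr_left ih]
    refine hL.imp_of_mem fun {s t} hs ht hst => ?_
    rcases hst.lt_or_eq with h | h
    · exact Or.inr ⟨hu t ht, hu s hs, h⟩
    · exact Or.inl (RTree.word_injOn (hu s hs) (hu t ht) h.symm)

theorem correspondsToLyndon_lyndonHallSet (A : Type u) [LinearOrder A] :
    (lyndonHallSet A).CorrespondsToLyndon where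
  bijOn := by
    refine ⟨fun t ht => ?_, fun s hs t ht h => ?_, fun w hw => ?_⟩
    · rw [foliage_lyndonHallSet ht]
      exact RTree.IsLyndon.isLyndonWord ht
    · rw [foliage_lyndonHallSet hs, foliage_lyndonHallSet ht] at h
      exact RTree.word_injOn hs ht h
    · obtain ⟨t, ht, rfl⟩ := RTree.exists_isLyndon_word_eq hw
      exact ⟨t, ht, foliage_lyndonHallSet ht⟩
  lt_iff s hs t ht := by
    rw [foliage_lyndonHallSet hs, foliage_lyndonHallSet ht]
    exact ⟨fun h => h.2.2, fun h => ⟨hs, ht, h⟩⟩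

namespace CorrespondsToLyndon

variable {H : HallSet A}

theorem eq_or_lt (hH : H.CorrespondsToLyndon) {s t : RTree A} (hs : s ∈ H.carrier)
    (ht : t ∈ H.carrier) (h : H.foliage t ≤ H.foliage s) : s = t ∨ H.lt t s := by
  rcases h.lt_or_eq with h | h
  · exact Or.inr ((hH.lt_iff t ht s hs).2 h)
  · exact Or.inl (hH.bijOn.injOn hs ht h.symm)

/-- The order of `H` is the alphabetical order of foliages, so foliage and word list the children in
the same order. The foliage thus does not depend on `H`. -/
theorem foliage_eq_word (hH : H.CorrespondsToLyndon) {t : RTree A} (ht : t ∈ H.carrier) :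
    H.foliage t = t.word := by
  induction t using RTree.induction with
  | h a u ih =>
    obtain ⟨L, rfl, hL⟩ := u.exists_pairwise_ge H.foliage
    have hc := fun s hs => (H.lt_of_mem_children a _ ht s hs).1
    have e : ∀ s ∈ L, H.foliage s = s.word := fun s hs => ih s hs (hc s hs)
    rw [foliage_node_coe, List.map_congr_left e, RTree.word_node_coe]
    · exact hL.imp_of_mem fun {s t} hs ht hst => by rwa [← e s hs, ← e t ht]
    · exact hL.imp_of_mem fun {s t} hs ht hst => hH.eq_or_lt (hc s hs) (hc t ht) hst

theorem isLyndon (hH : H.CorrespondsToLyndon) {t : RTree A} (ht : t ∈ H.carrier) : t.IsLyndon := by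
  induction t using RTree.induction with
  | h a u ih =>
    refine .intro a u (fun s hs => ih s hs (H.lt_of_mem_children a u ht s hs).1) ?_
    rw [← hH.foliage_eq_word ht]
    exact hH.bijOn.mapsTo ht

/-- For the converse, surjectivity of the foliage provides a member of `H` with the same word, and
words separate Lyndon trees. -/
theorem mem_carrier_iff (hH : H.CorrespondsToLyndon) {t : RTree A} : t ∈ H.carrier ↔ t.IsLyndon := by
  refine ⟨hH.isLyndon, fun ht => ?_⟩
  obtain ⟨s, hs, e⟩ := hH.bijOn.surjOn ht.isLyndonWord
  rw [hH.foliage_eq_word hs] at e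
  exact RTree.word_injOn (hH.isLyndon hs) ht e ▸ hs

theorem eq_lyndonHallSet (hH : H.CorrespondsToLyndon) : H = lyndonHallSet A := by
  have h1 : H.carrier = (lyndonHallSet A).carrier := Set.ext fun t => hH.mem_carrier_iff
  have h2 : H.lt = (lyndonHallSet A).lt := by
    ext s t
    constructor
    · intro h
      obtain ⟨hs, ht⟩ := H.mem_of_lt s t h
      have := (hH.lt_iff s hs t ht).1 h
      rw [hH.foliage_eq_word hs, hH.foliage_eq_word ht] at this
      exact ⟨hH.isLyndon hs, hH.isLyndon ht, this⟩
    · rintro ⟨hs, ht, h⟩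
      rw [← hH.mem_carrier_iff] at hs ht
      rw [← hH.foliage_eq_word hs, ← hH.foliage_eq_word ht] at h
      exact (hH.lt_iff s hs t ht).2 h
  cases H
  cases h1
  cases h2
  rfl

end CorrespondsToLyndon

end

end HallSet

/-! ### Hall polynomials span the free Lie algebra -/

namespace HallSet

variable {A : Type u} (H : HallSet A)

theorem exists_smallest (u : Forest A) (hu : ∀ x ∈ u, x ∈ H.carrier) (h0 : u ≠ 0) :
    ∃ s ∈ u, ∀ x ∈ u, x = s ∨ H.lt s x := by
  induction u using Multiset.induction with
  | empty => exact absurd rfl h0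
  | cons a u ih =>
    by_cases h1 : u = 0
    · exact ⟨a, by simp, by simp [h1]⟩
    · obtain ⟨s, hs, h⟩ := ih (fun x hx => hu x (Multiset.mem_cons_of_mem hx)) h1
      rcases H.lt_total a (hu a (by simp)) s (hu s (by simp [hs])) with has | rfl | has
      · refine ⟨a, by simp, fun x hx => ?_⟩
        rcases Multiset.mem_cons.1 hx with rfl | hx
        · exact Or.inl rfl
        · rcases h x hx with rfl | hx
          · exact Or.inr has
          · exact Or.inr (H.lt_trans _ _ _ has hx)
      · refine ⟨a, by simp, fun x hx => ?_⟩
        rcases Multiset.mem_cons.1 hx with rfl | hx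
        · exact Or.inl rfl
        · exact h x hx
      · refine ⟨s, by simp [hs], fun x hx => ?_⟩
        rcases Multiset.mem_cons.1 hx with rfl | hx
        · exact Or.inr has
        · exact h x hx

/-- Grafting copies of a tree that is at most as large as the children: only the other children
matter. -/
theorem node_cons_mem_iff (a : A) (u : Forest A) (s : RTree A) (hs : s ∈ H.carrier)
    (hu : ∀ x ∈ u, x ∈ H.carrier ∧ (x = s ∨ H.lt s x)) :
    RTree.node a (s ::ₘ u) ∈ H.carrier ↔
      RTree.node a u ∈ H.carrier ∧ H.lt (RTree.node a u) s := by
  classical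
  obtain ⟨v, r, hv, rfl⟩ : ∃ (v : Forest A) (r : ℕ), (∀ x ∈ v, x ∈ H.carrier ∧ H.lt s x) ∧
      u = v + Multiset.replicate r s := by
    refine ⟨u.filter (· ≠ s), u.count s, fun x hx => ?_, ?_⟩
    · obtain ⟨h1, h2⟩ := Multiset.mem_filter.1 hx
      exact ⟨(hu x h1).1, (hu x h1).2.resolve_left h2⟩
    · rw [← Multiset.filter_eq', add_comm]
      exact (Multiset.filter_add_not _ _).symm
  have h1 := H.node_mem_iff a v s (r + 1) (by omega) hs hv
  rw [Multiset.replicate_succ, Multiset.add_cons] at h1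
  rw [h1]
  rcases Nat.eq_zero_or_pos r with rfl | hr
  · simp
  · rw [← H.node_mem_iff a v s r hr hs hv]
    exact ⟨fun h => ⟨h, (H.lt_of_mem_children a _ h s
      (Multiset.mem_add.2 (Or.inr (Multiset.mem_replicate.2 ⟨hr.ne', rfl⟩)))).2⟩, fun h => h.1⟩

theorem exists_isStdDecomp {a : A} {u : Forest A} (h : RTree.node a u ∈ H.carrier) (hu : u ≠ 0) :
    ∃ t₁ t₂, H.IsStdDecomp (RTree.node a u) t₁ t₂ ∧ t₁ ∈ H.carrier ∧ t₂ ∈ H.carrier ∧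
      H.lt t₁ t₂ ∧ H.lt (RTree.node a u) t₂ ∧ ∀ x ∈ u, x = t₂ ∨ H.lt t₂ x := by
  have hc := H.lt_of_mem_children a u h
  obtain ⟨s, hs, hmin⟩ := H.exists_smallest u (fun x hx => (hc x hx).1) hu
  obtain ⟨v, rfl⟩ := Multiset.exists_cons_of_mem hs
  have hm : ∀ x ∈ v, x ∈ s ::ₘ v := fun x hx => Multiset.mem_cons_of_mem hx
  obtain ⟨h1, h2⟩ := (H.node_cons_mem_iff a v s (hc s hs).1
    fun x hx => ⟨(hc x (hm x hx)).1, hmin x (hm x hx)⟩).1 h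
  exact ⟨_, s, ⟨a, v, rfl, rfl, fun x hx => hmin x (hm x hx)⟩, h1, (hc s hs).1, h2, (hc s hs).2,
    hmin⟩

/-- The multiset of the labels in the foliage of a tree. -/
noncomputable def content (t : RTree A) : Multiset A := (H.foliage t : Multiset A)

variable {H} in
theorem IsStdDecomp.content_eq {t t₁ t₂ : RTree A} (h : H.IsStdDecomp t t₁ t₂) :
    H.content t = H.content t₁ + H.content t₂ := by
  rw [content, H.foliage_of_isStdDecomp h, ← Multiset.coe_add]
  rfl

theorem content_ne_zero (t : RTree A) : H.content t ≠ 0 := by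
  rw [content, Ne, Multiset.coe_eq_zero]
  induction hn : t.size using Nat.strong_induction_on generalizing t with
  | _ n ih =>
    by_cases h : ∃ p : RTree A × RTree A, H.IsStdDecomp t p.1 p.2
    · obtain ⟨p, hp⟩ := h
      rw [H.foliage_of_isStdDecomp hp, List.append_eq_nil_iff]
      exact fun h => ih _ (hn ▸ hp.size_lt.1) _ rfl h.1
    · rw [foliage, dif_neg h]
      simp

variable (K : Type*) [CommRing K]

/-- The span of the Hall polynomials of given content of the Hall trees smaller than `b`. -/
noncomputable def polySpan (b : RTree A) (C : Multiset A) : Submodule K (FreeLieAlgebra K A) :=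
  Submodule.span K {x | ∃ r, H.lt r b ∧ H.content r = C ∧ x = H.poly K r}

theorem polySpan_mono {b b' : RTree A} (h : H.lt b b') (C : Multiset A) :
    H.polySpan K b C ≤ H.polySpan K b' C := by
  refine Submodule.span_mono ?_
  rintro _ ⟨r, h1, h2, rfl⟩
  exact ⟨r, H.lt_trans _ _ _ h1 h, h2, rfl⟩

/-- Double induction: on the number of letters, then, for fixed total content `C`, on the number of
Hall trees below `t` with content at most `C`. If no child of `s` is below `t`, grafting `t` onto
`s` gives a Hall tree whose polynomial is the bracket. Otherwise `s = (s₁, s₂)` with `s₁ < s₂ < t`,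
and Jacobi gives `[[s₁,s₂],t] = [s₁,[s₂,t]] - [s₂,[s₁,t]]`. The inner brackets have fewer letters;
the outer ones then involve only trees below `t`. -/
theorem lie_mem_polySpan (hfin : ∀ C, {t | t ∈ H.carrier ∧ H.content t ≤ C}.Finite)
    (s t : RTree A) (hst : H.lt s t) :
    ⁅H.poly K s, H.poly K t⁆ ∈ H.polySpan K t (H.content s + H.content t) := by
  induction hN : (H.content s + H.content t).card using Nat.strong_induction_on
    generalizing s t with
  | _ N ihN =>
  generalize hC : H.content s + H.content t = C at hN
  induction hn : {r | (r ∈ H.carrier ∧ H.content r ≤ C) ∧ H.lt r t}.ncard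
    using Nat.strong_induction_on generalizing s t with
  | _ n ihn =>
  subst hn hN
  obtain ⟨hs, ht⟩ := H.mem_of_lt s t hst
  have htC : H.content t ≤ C := hC ▸ Multiset.le_add_left _ _
  -- The second induction applies because `y` itself lies below `t` but not below `y`.
  have smaller : ∀ x y, H.lt x y → H.lt y t → H.content x + H.content y = C →
      ⁅H.poly K x, H.poly K y⁆ ∈ H.polySpan K t C := by
    intro x y hxy hyt e
    refine H.polySpan_mono K hyt C (ihn _ (Set.ncard_lt_ncard ?_ ?_) x y hxy e rfl)
    · refine ⟨fun r hr => ⟨hr.1, H.lt_trans _ _ _ hr.2 hyt⟩, fun hsub => ?_⟩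
      exact H.lt_irrefl y (@hsub y ⟨⟨(H.mem_of_lt x y hxy).2, e ▸ Multiset.le_add_left _ _⟩, hyt⟩).2
    · exact (hfin C).subset fun r hr => hr.1
  have bracket : ∀ (q : RTree A) (D : Multiset A), H.lt q t → H.content q + D = C →
      ∀ x ∈ H.polySpan K t D, ⁅H.poly K q, x⁆ ∈ H.polySpan K t C := by
    intro q D hq e x hx
    refine Submodule.span_induction ?_ ?_ ?_ ?_ hx
    · rintro _ ⟨r, hr, rfl, rfl⟩
      rcases H.lt_total q (H.mem_of_lt q t hq).1 r (H.mem_of_lt r t hr).1 with h | rfl | h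
      · exact smaller q r h hr e
      · simp
      · rw [← lie_skew]
        exact neg_mem (smaller r q h hq (by rw [add_comm, e]))
    · simp
    · intro y z _ _ hy hz
      rw [lie_add]
      exact add_mem hy hz
    · intro c y _ hy
      rw [lie_smul]
      exact Submodule.smul_mem _ _ hy
  obtain ⟨a, u, rfl⟩ := s.exists_eq_node
  by_cases hu : ∀ x ∈ u, x = t ∨ H.lt t x
  · have hmem : RTree.node a (t ::ₘ u) ∈ H.carrier := (H.node_cons_mem_iff a u t ht
      fun x hx => ⟨(H.lt_of_mem_children a u hs x hx).1, hu x hx⟩).2 ⟨hs, hst⟩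
    have hd : H.IsStdDecomp (RTree.node a (t ::ₘ u)) (RTree.node a u) t := ⟨a, u, rfl, rfl, hu⟩
    refine Submodule.subset_span ⟨_, (H.lt_of_mem_children a _ hmem t (by simp)).2, ?_,
      (H.poly_of_isStdDecomp K hd).symm⟩
    rw [hd.content_eq, hC]
  · obtain ⟨x, hx, hxt⟩ : ∃ x ∈ u, ¬ (x = t ∨ H.lt t x) := by push Not at hu ⊢; exact hu
    obtain ⟨s₁, s₂, hd, hs₁, hs₂, h12, -, hmin⟩ := H.exists_isStdDecomp hs
      (by rintro rfl; simp at hx)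
    have hx' : H.lt x t := by
      rcases H.lt_total x (H.lt_of_mem_children a u hs x hx).1 t ht with h | h | h
      · exact h
      · exact absurd (Or.inl h) hxt
      · exact absurd (Or.inr h) hxt
    have h2t : H.lt s₂ t := by
      rcases hmin x hx with rfl | h
      · exact hx'
      · exact H.lt_trans _ _ _ h hx'
    have h1t := H.lt_trans _ _ _ h12 h2t
    have c1 := Multiset.card_pos.2 (H.content_ne_zero s₁)
    have c2 := Multiset.card_pos.2 (H.content_ne_zero s₂)
    rw [hd.content_eq] at hC
    rw [H.poly_of_isStdDecomp K hd, lie_lie]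
    refine sub_mem (bracket s₁ _ h1t (by rw [← hC, add_assoc]) _ (ihN _ ?_ s₂ t h2t rfl))
      (bracket s₂ _ h2t (by rw [← hC, add_left_comm, add_assoc]) _ (ihN _ ?_ s₁ t h1t rfl))
    · rw [← hC]
      simp only [Multiset.card_add]
      omega
    · rw [← hC]
      simp only [Multiset.card_add]
      omega

theorem span_poly (hfin : ∀ C, {t | t ∈ H.carrier ∧ H.content t ≤ C}.Finite) :
    Submodule.span K (Set.range fun t : H.carrier => H.poly K t.1) = ⊤ := by
  set S := Submodule.span K (Set.range fun t : H.carrier => H.poly K t.1) with hS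
  have hle : ∀ b C, H.polySpan K b C ≤ S := by
    refine fun b C => Submodule.span_mono ?_
    rintro _ ⟨r, hr, -, rfl⟩
    exact ⟨⟨r, (H.mem_of_lt r b hr).1⟩, rfl⟩
  have hlie : ∀ x ∈ S, ∀ y ∈ S, ⁅x, y⁆ ∈ S := by
    intro x hx y hy
    refine Submodule.span_induction₂ (p := fun x y _ _ => ⁅x, y⁆ ∈ S) ?_ ?_ ?_ ?_ ?_ ?_ ?_ hx hy
    · rintro _ _ ⟨s, rfl⟩ ⟨t, rfl⟩
      rcases H.lt_total s s.2 t t.2 with h | h | h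
      · exact hle _ _ (H.lie_mem_polySpan K hfin s t h)
      · simp [h]
      · simp only
        rw [← lie_skew]
        exact neg_mem (hle _ _ (H.lie_mem_polySpan K hfin t s h))
    · simp
    · simp
    · intro x y z _ _ _ h h'
      rw [add_lie]
      exact add_mem h h'
    · intro x y z _ _ _ h h'
      rw [lie_add]
      exact add_mem h h'
    · intro c x y _ _ h
      rw [smul_lie]
      exact Submodule.smul_mem _ _ h
    · intro c x y _ _ h
      rw [lie_smul]
      exact Submodule.smul_mem _ _ h
  -- The generators lift to `S'`; the lift followed by the inclusion fixes them, hence is the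
  -- identity, so `S'` is everything.
  let S' : LieSubalgebra K (FreeLieAlgebra K A) := { S with lie_mem' := fun hx hy => hlie _ hx _ hy }
  let F : FreeLieAlgebra K A →ₗ⁅K⁆ S' := FreeLieAlgebra.lift K fun a =>
    ⟨FreeLieAlgebra.of K a, Submodule.subset_span ⟨⟨_, H.leaf_mem a⟩, H.poly_leaf K a⟩⟩
  have hF : S'.incl.comp F = LieHom.id := FreeLieAlgebra.hom_ext fun a => by
    simp [F, FreeLieAlgebra.lift_of_apply]
  refine eq_top_iff.2 fun x _ => ?_
  have : ((F x : S') : FreeLieAlgebra K A) = x := congrArg (fun f => f x) hF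
  exact this ▸ (F x).2

end HallSet

/-! ### Triangular families in the free associative algebra -/

section Triangular

variable (K : Type*) [CommRing K] {A : Type u}

/-- The word `w` as an element of the free associative algebra. -/
noncomputable def wordMonomial (w : List A) : FreeAlgebra K A := (w.map (FreeAlgebra.ι K)).prod

theorem wordMonomial_append (u v : List A) :
    wordMonomial K (u ++ v) = wordMonomial K u * wordMonomial K v := by
  simp [wordMonomial]

theorem basisFreeMonoid_ofList (w : List A) :
    FreeAlgebra.basisFreeMonoid K A (FreeMonoid.ofList w) = wordMonomial K w := by
  have h : FreeAlgebra.equivMonoidAlgebraFreeMonoid (wordMonomial K w) =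
      MonoidAlgebra.single (FreeMonoid.ofList w) (1 : K) := by
    induction w with
    | nil => simp [wordMonomial, MonoidAlgebra.one_def]
    | cons a w ih =>
      rw [← List.singleton_append, wordMonomial_append, map_mul, ih, FreeMonoid.ofList_append,
        ← mul_one (1 : K), ← MonoidAlgebra.single_mul_single]
      simp [wordMonomial, FreeAlgebra.equivMonoidAlgebraFreeMonoid]
  rw [FreeAlgebra.basisFreeMonoid, Module.Basis.map_apply, LinearEquiv.symm_apply_eq]
  change _ = (MonoidAlgebra.coeffLinearEquiv K)
    (FreeAlgebra.equivMonoidAlgebraFreeMonoid (wordMonomial K w))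
  rw [h]
  simp

/-- The basis of words. -/
noncomputable def wordBasis (A : Type u) : Module.Basis (List A) K (FreeAlgebra K A) :=
  (FreeAlgebra.basisFreeMonoid K A).reindex FreeMonoid.toList

@[simp] theorem wordBasis_apply (w : List A) : wordBasis K A w = wordMonomial K w := by
  rw [wordBasis, Module.Basis.reindex_apply]
  exact basisFreeMonoid_ofList K w

theorem mul_mem_span_wordMonomial {S T R : Set (List A)} (h : ∀ u ∈ S, ∀ v ∈ T, u ++ v ∈ R)
    {x y : FreeAlgebra K A} (hx : x ∈ Submodule.span K (wordMonomial K '' S))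
    (hy : y ∈ Submodule.span K (wordMonomial K '' T)) :
    x * y ∈ Submodule.span K (wordMonomial K '' R) := by
  have := Submodule.mul_mem_mul hx hy
  rw [Submodule.span_mul_span] at this
  refine Submodule.span_mono ?_ this
  rintro _ ⟨_, ⟨u, hu, rfl⟩, _, ⟨v, hv, rfl⟩, rfl⟩
  exact ⟨u ++ v, h u hu v hv, wordMonomial_append K u v⟩

theorem Multiset.finite_setOf_coe_le (C : Multiset A) :
    {w : List A | (w : Multiset A) ≤ C}.Finite := by
  classical
  refine ((C.powerset.toFinset.finite_toSet).biUnion fun D _ =>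
    (D.lists.toFinset.finite_toSet)).subset fun w hw => ?_
  simp only [Set.mem_iUnion]
  exact ⟨w, by simpa using hw, by simp⟩

variable {K} in
theorem coord_eq_zero_of_mem_span {S : Set (List A)} {x : FreeAlgebra K A}
    (hx : x ∈ Submodule.span K (wordMonomial K '' S)) {w : List A} (hw : w ∉ S) :
    (wordBasis K A).coord w x = 0 := by
  refine Submodule.span_induction ?_ (map_zero _) ?_ ?_ hx
  · rintro _ ⟨v, hv, rfl⟩
    rw [← wordBasis_apply, Module.Basis.coord_apply, Module.Basis.repr_self,
      Finsupp.single_eq_of_ne]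
    rintro rfl
    exact hw hv
  · intro y z _ _ hy hz
    rw [map_add, hy, hz, add_zero]
  · intro c y _ hy
    rw [map_smul, hy, smul_zero]

variable [LinearOrder A]

/-- The rearrangements of `w` that are larger than `w`. -/
def largerRearrangements (w : List A) : Set (List A) := {v | v.Perm w ∧ w < v}

theorem finite_largerRearrangements (w : List A) : (largerRearrangements w).Finite :=
  (Multiset.finite_setOf_coe_le (w : Multiset A)).subset fun _ hv => (Multiset.coe_eq_coe.2 hv.1).le

/-- `x` is the sum of `w` and a combination of larger rearrangements of `w`. -/
def HasLeadingWord (x : FreeAlgebra K A) (w : List A) : Prop :=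
  x - wordMonomial K w ∈ Submodule.span K (wordMonomial K '' largerRearrangements w)

variable {K}

/-- Rearrangements preserve length, so a strict inequality between them persists after appending
arbitrary words. Merely larger words could be extensions, for which this fails. -/
theorem HasLeadingWord.mul {x y : FreeAlgebra K A} {u v : List A} (hx : HasLeadingWord K x u)
    (hy : HasLeadingWord K y v) : HasLeadingWord K (x * y) (u ++ v) := by
  have e : x * y - wordMonomial K (u ++ v) = (x - wordMonomial K u) * (y - wordMonomial K v) +
      wordMonomial K u * (y - wordMonomial K v) + (x - wordMonomial K u) * wordMonomial K v := by
    rw [wordMonomial_append]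
    noncomm_ring
  have hm : ∀ w : List A, wordMonomial K w ∈ Submodule.span K (wordMonomial K '' {w}) :=
    fun w => Submodule.subset_span ⟨w, rfl, rfl⟩
  rw [HasLeadingWord, e]
  refine add_mem (add_mem (mul_mem_span_wordMonomial K ?_ hx hy)
    (mul_mem_span_wordMonomial K ?_ (hm u) hy))
    (mul_mem_span_wordMonomial K ?_ hx (hm v))
  · rintro u' hu v' hv
    exact ⟨hu.1.append hv.1, List.append_lt_append_of_length_le hu.2 hu.1.length_eq.le _ _⟩
  · rintro _ rfl v' hv
    exact ⟨hv.1.append_left _, (List.append_lt_append_left_iff _ _ _).2 hv.2⟩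
  · rintro u' hu _ rfl
    exact ⟨hu.1.append_right _, List.append_lt_append_of_length_le hu.2 hu.1.length_eq.le _ _⟩

theorem HasLeadingWord.mem_span {x : FreeAlgebra K A} {w : List A} (hx : HasLeadingWord K x w)
    {R : Set (List A)} (hw : w ∈ R) (hR : largerRearrangements w ⊆ R) :
    x ∈ Submodule.span K (wordMonomial K '' R) := by
  rw [← sub_add_cancel x (wordMonomial K w)]
  exact add_mem (Submodule.span_mono (Set.image_mono hR) hx) (Submodule.subset_span ⟨w, hw, rfl⟩)

theorem HasLeadingWord.coord_self {x : FreeAlgebra K A} {w : List A} (hx : HasLeadingWord K x w) :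
    (wordBasis K A).coord w x = 1 := by
  rw [← sub_add_cancel x (wordMonomial K w), map_add,
    coord_eq_zero_of_mem_span hx fun h => lt_irrefl _ h.2, zero_add, ← wordBasis_apply,
    Module.Basis.coord_apply, Module.Basis.repr_self, Finsupp.single_eq_same]

theorem HasLeadingWord.coord_eq_zero {x : FreeAlgebra K A} {w v : List A}
    (hx : HasLeadingWord K x w) (hv : v < w) : (wordBasis K A).coord v x = 0 :=
  coord_eq_zero_of_mem_span (hx.mem_span (R := {v | w ≤ v}) (le_refl w) fun _ h => h.2.le)
    (not_le.2 hv)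

/-- In a vanishing combination, the coordinate at the smallest leading word with nonzero coefficient
sees only that term. -/
theorem linearIndependent_of_hasLeadingWord {J : Type*} (q : J → FreeAlgebra K A) (e : J → List A)
    (he : Function.Injective e) (h : ∀ j, HasLeadingWord K (q j) (e j)) :
    LinearIndependent K q := by
  classical
  rw [linearIndependent_iff']
  intro s g hg i hi
  by_contra hne
  obtain ⟨m, hm, hmin⟩ := (s.filter fun i => g i ≠ 0).exists_min_image e
    ⟨i, Finset.mem_filter.2 ⟨hi, hne⟩⟩
  rw [Finset.mem_filter] at hm
  have := congrArg ((wordBasis K A).coord (e m)) hg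
  rw [map_sum, map_zero, Finset.sum_eq_single m] at this
  · rw [map_smul, (h m).coord_self, smul_eq_mul, mul_one] at this
    exact hm.2 this
  · intro j hj hjm
    by_cases hj0 : g j = 0
    · simp [hj0]
    · rw [map_smul, (h j).coord_eq_zero, smul_zero]
      exact lt_of_le_of_ne (hmin j (Finset.mem_filter.2 ⟨hj, hj0⟩)) fun e' => hjm (he e').symm
  · exact fun h => absurd hm.1 h

theorem span_eq_top_of_hasLeadingWord {J : Type*} (q : J → FreeAlgebra K A) (e : J → List A)
    (he : Function.Surjective e) (h : ∀ j, HasLeadingWord K (q j) (e j)) :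
    Submodule.span K (Set.range q) = ⊤ := by
  have key : ∀ w, wordMonomial K w ∈ Submodule.span K (Set.range q) := by
    intro w
    -- The order on words need not be well-founded, so the induction counts the finitely many larger
    -- rearrangements.
    induction hn : (largerRearrangements w).ncard using Nat.strong_induction_on
      generalizing w with
    | _ n ih =>
      subst hn
      obtain ⟨j, rfl⟩ := he w
      have h1 : q j - wordMonomial K (e j) ∈ Submodule.span K (Set.range q) := by
        refine Submodule.span_le.2 ?_ (h j)
        rintro _ ⟨v, hv, rfl⟩
        refine ih _ (Set.ncard_lt_ncard ⟨fun x hx => ⟨hx.1.trans hv.1, hv.2.trans hx.2⟩,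
          fun hsub => ?_⟩ (finite_largerRearrangements _)) v rfl
        exact lt_irrefl _ (hsub hv).2
      have h2 := sub_mem (Submodule.subset_span (Set.mem_range_self j)) h1
      rwa [sub_sub_cancel] at h2
  rw [eq_top_iff, ← (wordBasis K A).span_eq]
  refine Submodule.span_le.2 ?_
  rintro _ ⟨w, rfl⟩
  simpa using key w

end Triangular

namespace HallSet.CorrespondsToLyndon

variable {A : Type u} [LinearOrder A] {H : HallSet A}

theorem finite_content_le (hH : H.CorrespondsToLyndon) (C : Multiset A) :
    {t | t ∈ H.carrier ∧ H.content t ≤ C}.Finite :=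
  Set.Finite.of_finite_image ((Multiset.finite_setOf_coe_le C).subset (by
    rintro _ ⟨t, ht, rfl⟩
    exact ht.2)) (hH.bijOn.injOn.mono fun _ ht => ht.1)

end HallSet.CorrespondsToLyndon

/-! ### Hall polynomials and their decreasing products as noncommutative polynomials -/

section

attribute [local instance] LieRing.ofAssociativeRing

variable (K : Type*) [CommRing K] {A : Type u}

/-- The map from the free Lie algebra to the free associative algebra. -/
noncomputable def FreeLieAlgebra.toFreeAlgebra : FreeLieAlgebra K A →ₗ[K] FreeAlgebra K A :=
  (FreeLieAlgebra.universalEnvelopingEquivFreeAlgebra K A).toLinearMap ∘ₗ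
    (UniversalEnvelopingAlgebra.ι K : FreeLieAlgebra K A →ₗ⁅K⁆ _).toLinearMap

theorem FreeLieAlgebra.toFreeAlgebra_apply (x : FreeLieAlgebra K A) :
    toFreeAlgebra K x = FreeLieAlgebra.universalEnvelopingEquivFreeAlgebra K A
      (UniversalEnvelopingAlgebra.ι K x) := rfl

theorem FreeLieAlgebra.toFreeAlgebra_of (a : A) :
    toFreeAlgebra K (FreeLieAlgebra.of K a) = FreeAlgebra.ι K a := by
  simp [toFreeAlgebra_apply, universalEnvelopingEquivFreeAlgebra]

theorem FreeLieAlgebra.toFreeAlgebra_lie (x y : FreeLieAlgebra K A) :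
    toFreeAlgebra K ⁅x, y⁆ = toFreeAlgebra K x * toFreeAlgebra K y -
      toFreeAlgebra K y * toFreeAlgebra K x := by
  simp only [toFreeAlgebra_apply, LieHom.map_lie, LieRing.of_associative_ring_bracket, map_sub,
    map_mul]

variable [LinearOrder A]

/-- The words of the decreasing products: the concatenation of the foliages. -/
noncomputable def HallSet.DecreasingSeq.foliage {H : HallSet A} (l : H.DecreasingSeq) : List A :=
  (l.1.map fun t => H.foliage t.1).flatten

namespace HallSet.CorrespondsToLyndon

variable {H : HallSet A}

theorem isLyndonSeq (hH : H.CorrespondsToLyndon) (l : H.DecreasingSeq) :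
    IsLyndonSeq (l.1.map fun t => H.foliage t.1) := by
  refine ⟨fun w hw => ?_, List.pairwise_map.2 (l.2.imp fun {s t} h => ?_)⟩
  · obtain ⟨t, -, rfl⟩ := List.mem_map.1 hw
    exact hH.bijOn.mapsTo t.2
  · rcases h with rfl | h
    · exact le_rfl
    · exact ((hH.lt_iff t.1 t.2 s.1 s.2).1 h).le

/-- Existence and uniqueness of the Lyndon factorization, carried over to Hall trees. -/
theorem foliage_decreasingSeq_bijective (hH : H.CorrespondsToLyndon) :
    Function.Bijective (DecreasingSeq.foliage (H := H)) := by
  have hinj : Function.Injective fun t : H.carrier => H.foliage t.1 :=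
    fun s t h => Subtype.ext (hH.bijOn.injOn s.2 t.2 h)
  refine ⟨fun l m h => Subtype.ext (List.map_injective_iff.2 hinj
    ((hH.isLyndonSeq l).eq_of_flatten_eq (hH.isLyndonSeq m) h)), fun w => ?_⟩
  obtain ⟨L, hL, rfl⟩ := exists_isLyndonSeq w
  obtain ⟨l, rfl⟩ : L ∈ Set.range (List.map fun t : H.carrier => H.foliage t.1) := by
    rw [Set.range_list_map]
    intro w hw
    obtain ⟨t, ht, e⟩ := hH.bijOn.surjOn (hL.1 w hw)
    exact ⟨⟨t, ht⟩, e⟩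
  refine ⟨⟨l, (List.pairwise_map.1 hL.2).imp fun {s t} h => ?_⟩, rfl⟩
  exact (hH.eq_or_lt s.2 t.2 h).imp_left Subtype.ext

theorem hasLeadingWord_poly (hH : H.CorrespondsToLyndon) {t : RTree A} (ht : t ∈ H.carrier) :
    HasLeadingWord K (FreeLieAlgebra.toFreeAlgebra K (H.poly K t)) (H.foliage t) := by
  induction hn : t.size using Nat.strong_induction_on generalizing t with
  | _ n ih =>
    subst hn
    obtain ⟨a, u, rfl⟩ := t.exists_eq_node
    by_cases hu : u = 0
    · subst hu
      simp [HasLeadingWord, H.poly_leaf, H.foliage_leaf, wordMonomial,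
        FreeLieAlgebra.toFreeAlgebra_of]
    · obtain ⟨t₁, t₂, hd, h1, h2, -, -, -⟩ := H.exists_isStdDecomp ht hu
      have l1 := ih _ hd.size_lt.1 h1 rfl
      have l2 := ih _ hd.size_lt.2 h2 rfl
      have hw := hH.bijOn.mapsTo ht
      have hw1 := (hH.bijOn.mapsTo h1).1
      have hw2 := (hH.bijOn.mapsTo h2).1
      -- The subtracted product `p_{t₂} p_{t₁}` contributes only larger rearrangements: a Lyndon
      -- word `uv` satisfies `uv < v ≤ vu`.
      have hlt : H.foliage t₁ ++ H.foliage t₂ < H.foliage t₂ ++ H.foliage t₁ := by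
        rw [Set.mem_ofPred_eq, H.foliage_of_isStdDecomp hd] at hw
        exact (hw.2 _ _ hw1 hw2 rfl).trans_le (List.le_append_self _ _)
      rw [H.poly_of_isStdDecomp K hd, FreeLieAlgebra.toFreeAlgebra_lie,
        H.foliage_of_isStdDecomp hd, HasLeadingWord, sub_right_comm]
      refine sub_mem (l1.mul l2) ((l2.mul l1).mem_span ⟨List.perm_append_comm, hlt⟩
        fun v hv => ⟨hv.1.trans List.perm_append_comm, hlt.trans hv.2⟩)

theorem hasLeadingWord_prod (hH : H.CorrespondsToLyndon) (l : List H.carrier) :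
    HasLeadingWord K (l.map fun t => FreeLieAlgebra.toFreeAlgebra K (H.poly K t.1)).prod
      (l.map fun t => H.foliage t.1).flatten := by
  induction l with
  | nil => simp [HasLeadingWord, wordMonomial]
  | cons t l ih => exact (hH.hasLeadingWord_poly K t.2).mul ih

/-- Independence of the images under a linear map suffices, so injectivity of the map to the free
algebra is not needed. -/
theorem linearIndependent_poly (hH : H.CorrespondsToLyndon) :
    LinearIndependent K fun t : H.carrier => H.poly K t.1 :=
  .of_comp (FreeLieAlgebra.toFreeAlgebra K) <| linearIndependent_of_hasLeadingWord _
    (fun t : H.carrier => H.foliage t.1) (fun s t h => Subtype.ext (hH.bijOn.injOn s.2 t.2 h))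
    fun t => hH.hasLeadingWord_poly K t.2

/-- The Hall polynomials form a basis of the free Lie algebra. -/
noncomputable def polyBasis (hH : H.CorrespondsToLyndon) :
    Module.Basis H.carrier K (FreeLieAlgebra K A) :=
  .mk (hH.linearIndependent_poly K) (H.span_poly K hH.finite_content_le).ge

theorem polyBasis_apply (hH : H.CorrespondsToLyndon) (t : H.carrier) :
    hH.polyBasis K t = H.poly K t.1 := by
  rw [polyBasis, Module.Basis.mk_apply]

/-- The decreasing products of Hall polynomials form a basis of the free associative algebra. -/
noncomputable def prodBasis (hH : H.CorrespondsToLyndon) :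
    Module.Basis H.DecreasingSeq K (FreeAlgebra K A) :=
  .mk (linearIndependent_of_hasLeadingWord _ DecreasingSeq.foliage
      hH.foliage_decreasingSeq_bijective.1 fun l => hH.hasLeadingWord_prod K l.1)
    (span_eq_top_of_hasLeadingWord _ DecreasingSeq.foliage
      hH.foliage_decreasingSeq_bijective.2 fun l => hH.hasLeadingWord_prod K l.1).ge

theorem prodBasis_apply (hH : H.CorrespondsToLyndon) (l : H.DecreasingSeq) :
    hH.prodBasis K l =
      (l.1.map fun t => FreeLieAlgebra.toFreeAlgebra K (H.poly K t.1)).prod := by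
  rw [prodBasis, Module.Basis.mk_apply]

end HallSet.CorrespondsToLyndon

end

/-- There is exactly one Hall set of rooted trees labeled by `{f_n}` that corresponds to the Lyndon
words, and, for this Hall set: its Hall polynomials form a basis of `L_𝕌`; their decreasing products
form a basis of the enveloping algebra of `L_𝕌`; and, computed with `e_{-n} = f_n` in the algebra of
noncommutative polynomials in the `f_n`, these products form a basis of that algebra. -/
theorem corollary4p19 (K : Type*) [Field K] :
    (∃! H : HallSet Letter, H.CorrespondsToLyndon) ∧
    ∀ H : HallSet Letter, H.CorrespondsToLyndon →
      (∃ b : Module.Basis H.carrier K (LieU K), ∀ t, b t = H.poly K t.1) ∧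
      (∃ b : Module.Basis H.DecreasingSeq K (UniversalEnvelopingAlgebra K (LieU K)),
        ∀ l, b l = (l.1.map fun t => UniversalEnvelopingAlgebra.ι K (H.poly K t.1)).prod) ∧
      (∃ b : Module.Basis H.DecreasingSeq K (FreeAlgebra K Letter),
        ∀ l, b l =
          (l.1.map fun t => FreeLieAlgebra.universalEnvelopingEquivFreeAlgebra K Letter
            (UniversalEnvelopingAlgebra.ι K (H.poly K t.1))).prod) := by
  refine ⟨⟨lyndonHallSet Letter, HallSet.correspondsToLyndon_lyndonHallSet Letter,
    fun H hH => hH.eq_lyndonHallSet⟩, fun H hH => ⟨⟨hH.polyBasis K, hH.polyBasis_apply K⟩,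
      -- The basis of the free algebra is pulled back along the isomorphism with the enveloping
      -- algebra.
      ⟨(hH.prodBasis K).map (FreeLieAlgebra.universalEnvelopingEquivFreeAlgebra K
        Letter).symm.toLinearEquiv, fun l => ?_⟩, ⟨hH.prodBasis K, hH.prodBasis_apply K⟩⟩⟩
  rw [Module.Basis.map_apply, hH.prodBasis_apply K, AlgEquiv.toLinearEquiv_apply, map_list_prod,
    List.map_map]
  refine congrArg List.prod (List.map_congr_left fun t _ => ?_)
  exact AlgEquiv.symm_apply_apply _ _
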